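/- **Lemma.** Let $T$ be a rooted tree on $n$ nodes with root $r$ whose edges carry positive real weights. Let $d(u)$ denote the weighted distance from $r$ to $u$. A *weighted level ancestor query* is given a node $u\neq r$ and a number $x$ with $0<x\le d(u)$, and asks for the (unique) ancestor $v$ of $u$ (possibly $v = u$) with $d(v)\ge x$ and $d(\mathrm{parent}(v))<x$. In the pointer machine model, a data structure is a directed graph of bounded out-degree whose nodes (records) have a constant number of pointer fields and number fields. Its space is the number of its records. A query algorithm is a program with a constant number of pointer and number registers that reaches records only by following pointers and manipulates numbers only by comparisons and additions. Its running time is the number of executed instructions. There are constants $p,q,C\in\mathbb N$ and a single query program $P$, all independent of the tree, such that for every such $T$ there is a pointer machine data structure with at most $Cn$ records, each with $p$ pointer fields and $q$ number fields, in which every node of $T$ is represented by its own record and every stored number is the distance $d(w)$ of some node $w$ of $T$, with the following property. For every weighted level ancestor query $(u,x)$, the program $P$, started with a pointer to the record of $u$ and the number $x$, returns a pointer to the record of the answer $v$ in time at most $$C\left(1+\log_2\frac{d(u)}{d(v)-d(\mathrm{parent}(v))}\right).$$ -/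

import Mathlib

/-! ### Edge-weighted rooted trees and weighted level ancestors

A rooted tree is Mathlib's `RootedTree`: `a ≤ v` says that `a` is an ancestor of `v` (every node is an
ancestor of itself), `⊥` is the root, and `Order.pred v` is the parent of `v ≠ ⊥`.
The weight of the edge between `v ≠ ⊥` and its parent is `w v`; the value `w ⊥` is never used. -/

namespace WeightedTree

open Classical in
/-- The distance of `v` from the root: the total weight of the edges on the path from the root to `v`. -/
noncomputable def rootDist {T : RootedTree} [Fintype T] (w : T → ℝ) (v : T) : ℝ :=
  ∑ a ∈ Finset.univ.filter (fun a : T => a ≤ v ∧ a ≠ ⊥), w a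

theorem rootDist_bot {T : RootedTree} [Fintype T] (w : T → ℝ) : rootDist w ⊥ = 0 := by
  classical
  unfold rootDist
  apply Finset.sum_eq_zero
  intro a ha
  simp only [Finset.mem_filter, le_bot_iff] at ha
  exact absurd ha.2.1 ha.2.2

theorem rootDist_eq {T : RootedTree} [Fintype T] (w : T → ℝ) {v : T} (hv : v ≠ ⊥) :
    rootDist w v = rootDist w (Order.pred v) + w v := by
  classical
  have hlt : Order.pred v < v := Order.pred_lt_of_not_isMin (by simpa using hv)
  have h : Finset.univ.filter (fun a : T => a ≤ v ∧ a ≠ ⊥)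
      = insert v (Finset.univ.filter (fun a : T => a ≤ Order.pred v ∧ a ≠ ⊥)) := by
    ext a
    simp only [Finset.mem_filter, Finset.mem_univ, true_and, Finset.mem_insert]
    constructor
    · rintro ⟨h1, h2⟩
      rcases h1.eq_or_lt with h3 | h3
      · exact Or.inl h3
      · exact Or.inr ⟨Order.le_pred_of_lt h3, h2⟩
    · rintro (h1 | ⟨h1, h2⟩)
      · subst h1
        exact ⟨le_rfl, hv⟩
      · exact ⟨h1.trans hlt.le, h2⟩
  unfold rootDist
  rw [h, Finset.sum_insert, add_comm]
  simp only [Finset.mem_filter, not_and]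
  intro _ h1 _
  exact absurd h1 (not_le_of_gt hlt)

/-- `v` is an answer to the weighted level ancestor query for the node `u` and the number `x`: an ancestor of
`u` with `d(v) ≥ x` and `d(parent(v)) < x`. For `0 < x ≤ d(u)` there is exactly one, and it is not the root. -/
def IsLevelAncestor {T : RootedTree} [Fintype T] (w : T → ℝ) (u : T) (x : ℝ) (v : T) : Prop :=
  v ≤ u ∧ x ≤ rootDist w v ∧ rootDist w (Order.pred v) < x

end WeightedTree

/-! ### Pointer machines with comparisons and additions -/

namespace PointerMachine

/-- A pointer machine data structure with set of records `κ`: a directed graph of out-degree at most `p`, each of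
whose records holds `p` pointer fields (a pointer to a record, or null) and `q` number fields. -/
structure DataStructure (p q : ℕ) (κ : Type*) where
  ptrField : κ → Fin p → Option κ
  numField : κ → Fin q → ℝ

/-- The instructions. A machine has pointer registers and number registers, both named by natural numbers; a program
mentions only finitely many of them. Records are reached only through pointer fields, there is no arithmetic on
pointers, and numbers are only added and compared. -/
inductive Instr (p q : ℕ) where
  /-- pointer register `dst` := pointer field `f` of the record that pointer register `src` points to -/
  | loadPtr (dst src : ℕ) (f : Fin p)
  /-- number register `dst` := number field `f` of the record that pointer register `src` points to -/
  | loadNum (dst src : ℕ) (f : Fin q)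
  /-- pointer register `dst` := pointer register `src` -/
  | movePtr (dst src : ℕ)
  /-- number register `dst` := number register `src` -/
  | moveNum (dst src : ℕ)
  /-- number register `dst` := number register `a` + number register `b` -/
  | add (dst a b : ℕ)
  /-- go to instruction `l` if number register `a` ≤ number register `b` -/
  | ifLe (a b l : ℕ)
  /-- go to instruction `l` if pointer registers `a` and `b` are equal -/
  | ifEq (a b l : ℕ)
  /-- go to instruction `l` -/
  | goto (l : ℕ)
  /-- stop and return pointer register `src` -/
  | ret (src : ℕ)

/-- A program: a finite list of instructions, executed from instruction number `0`. -/
abbrev Program (p q : ℕ) := List (Instr p q)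

/-- A configuration: the number of the current instruction and the contents of the registers. -/
structure Config (κ : Type*) where
  pc : ℕ
  ptr : ℕ → Option κ
  num : ℕ → ℝ

/-- The initial configuration on input `(c, x)`: pointer register `0` points to the record `c` and number register `0`
holds `x`; the other pointer registers are null and the other number registers hold `0`. -/
def Config.init {κ : Type*} (c : κ) (x : ℝ) : Config κ where
  pc := 0
  ptr := fun i => if i = 0 then some c else none
  num := fun i => if i = 0 then x else 0

open Classical in
/-- The effect of one instruction other than `ret`. The data structure is only read, so it serves any number of
queries. Following a null pointer is an error (`none`). -/
noncomputable def exec {p q : ℕ} {κ : Type*} (D : DataStructure p q κ) (s : Config κ) :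
    Instr p q → Option (Config κ)
  | .loadPtr dst src f => (s.ptr src).map fun c =>
      { s with pc := s.pc + 1, ptr := Function.update s.ptr dst (D.ptrField c f) }
  | .loadNum dst src f => (s.ptr src).map fun c =>
      { s with pc := s.pc + 1, num := Function.update s.num dst (D.numField c f) }
  | .movePtr dst src => some
      { s with pc := s.pc + 1, ptr := Function.update s.ptr dst (s.ptr src) }
  | .moveNum dst src => some
      { s with pc := s.pc + 1, num := Function.update s.num dst (s.num src) }
  | .add dst a b => some
      { s with pc := s.pc + 1, num := Function.update s.num dst (s.num a + s.num b) }
  | .ifLe a b l => some { s with pc := if s.num a ≤ s.num b then l else s.pc + 1 }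
  | .ifEq a b l => some { s with pc := if s.ptr a = s.ptr b then l else s.pc + 1 }
  | .goto l => some { s with pc := l }
  | .ret _ => none

/-- `Run P D s t c`: started in configuration `s`, the program `P` on the data structure `D` executes exactly `t`
instructions, the last of which stops it and returns a pointer to the record `c`. -/
inductive Run {p q : ℕ} {κ : Type*} (P : Program p q) (D : DataStructure p q κ) :
    Config κ → ℕ → κ → Prop
  | ret {s : Config κ} {r : ℕ} {c : κ} (hi : P[s.pc]? = some (.ret r)) (hc : s.ptr r = some c) :
      Run P D s 1 c
  | step {s s' : Config κ} {i : Instr p q} {t : ℕ} {c : κ} (hi : P[s.pc]? = some i)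
      (hs : exec D s i = some s') (h : Run P D s' t c) : Run P D s (t + 1) c

end PointerMachine

universe u

open WeightedTree PointerMachine

namespace WeightedTree

/-! ### Depths and dyadic scales of edges -/

section Distance

variable {T : RootedTree} [Fintype T] {w : T → ℝ}

/-! Let the scale of an edge be the largest k such that (d(parent v), d(v)] contains a multiple of
2^k. Then w(v) < 2^(k+1) and 2^k ≤ d(v), and between two comparable nodes of equal scale lies one of
larger scale (`exists_scale`). Let `up a` be the nearest proper ancestor of larger scale, or the
root. All scales strictly between `up a` and `a` are then smaller than that of `a`.

A search between b and y follows the spine y, up y, up (up y), ..., b, on which scales increase, to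
the node a with d(up a) < x ≤ d(a). If a is the j-th spine node below b, its scale is at least j - 1
below the maximum allowed on this stretch, so O(j) time is paid for by the drop in scale. Either a
is the answer, or the search resumes between `up a` and the parent of a, where all scales are
smaller. The costs telescope to O(log d(u) - scale(v) + 1) (`exists_run_loop`), which the bound on
w(v) turns into the claim.

Reaching a in O(j) time requires descending from b. A stored midpoint of the spine decides between
climbing from y and descending a ladder from b. Doubling the long paths of the `up`-forest upwards
yields all ladders with two records per node (`exists_ladder`). -/

theorem rootDist_lt_of_lt (hw : ∀ v : T, v ≠ ⊥ → 0 < w v) {a b : T} (h : a < b) :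
    rootDist w a < rootDist w b := by
  classical
  unfold rootDist
  have hb : b ≠ ⊥ := (bot_le.trans_lt h).ne'
  refine Finset.sum_lt_sum_of_subset (i := b) ?_ ?_ ?_ (hw b hb) ?_
  · intro c hc
    simp only [Finset.mem_filter, Finset.mem_univ, true_and] at hc ⊢
    exact ⟨hc.1.trans h.le, hc.2⟩
  · simp [hb]
  · simp [h.not_ge]
  · intro c hc _
    simp only [Finset.mem_filter, Finset.mem_univ, true_and] at hc
    exact (hw c hc.2).le

theorem rootDist_le_of_le (hw : ∀ v : T, v ≠ ⊥ → 0 < w v) {a b : T} (h : a ≤ b) :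
    rootDist w a ≤ rootDist w b := by
  rcases h.eq_or_lt with rfl | h
  · exact le_rfl
  · exact (rootDist_lt_of_lt hw h).le

theorem rootDist_nonneg (hw : ∀ v : T, v ≠ ⊥ → 0 < w v) (a : T) : 0 ≤ rootDist w a := by
  rw [← rootDist_bot w]
  exact rootDist_le_of_le hw bot_le

theorem exists_isLevelAncestor {u : T} {x : ℝ} (hx : 0 < x) (hxu : x ≤ rootDist w u) :
    ∃ v, IsLevelAncestor w u x v := by
  induction u using WellFoundedLT.induction with
  | ind u ih =>
    have hu : u ≠ ⊥ := by
      rintro rfl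
      rw [rootDist_bot] at hxu
      exact absurd hx hxu.not_gt
    have hlt : Order.pred u < u := Order.pred_lt_of_not_isMin (by simpa using hu)
    by_cases h : x ≤ rootDist w (Order.pred u)
    · obtain ⟨v, hv⟩ := ih _ hlt h
      exact ⟨v, hv.1.trans hlt.le, hv.2⟩
    · exact ⟨u, le_rfl, hxu, not_le.1 h⟩

/-- The interval `(d(parent v), d(v)]` contains a multiple of `2 ^ k`. -/
def CoversMultiple (w : T → ℝ) (k : ℤ) (v : T) : Prop :=
  ∃ n : ℤ, rootDist w (Order.pred v) < n * (2 : ℝ) ^ k ∧ n * (2 : ℝ) ^ k ≤ rootDist w v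

theorem CoversMultiple.zpow_le (hw : ∀ v : T, v ≠ ⊥ → 0 < w v) {k : ℤ} {v : T}
    (h : CoversMultiple w k v) : (2 : ℝ) ^ k ≤ rootDist w v := by
  obtain ⟨n, h1, h2⟩ := h
  have h3 : (0 : ℝ) < n * (2 : ℝ) ^ k := (rootDist_nonneg hw _).trans_lt h1
  have h4 : (0 : ℝ) < 2 ^ k := by positivity
  have h5 : (0 : ℝ) < n := pos_of_mul_pos_left h3 h4.le
  have h6 : (1 : ℝ) ≤ n := by exact_mod_cast (by exact_mod_cast h5 : (0 : ℤ) < n)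
  nlinarith

/-- A half-open interval of length at least 2^k contains a multiple of 2^k: round its right end
down. -/
theorem coversMultiple_of_zpow_le {k : ℤ} {v : T} (hv : v ≠ ⊥) (h : (2 : ℝ) ^ k ≤ w v) :
    CoversMultiple w k v := by
  have h4 : (0 : ℝ) < 2 ^ k := by positivity
  refine ⟨⌊rootDist w v / 2 ^ k⌋, ?_, ?_⟩
  · have h1 := Int.lt_floor_add_one (rootDist w v / 2 ^ k)
    rw [div_lt_iff₀ h4] at h1
    have h2 := rootDist_eq w hv
    linarith
  · have h1 := Int.floor_le (rootDist w v / 2 ^ k)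
    rwa [le_div_iff₀ h4] at h1

theorem coversMultiple_succ_of_even {k n : ℤ} {v : T} (hn : Even n)
    (h1 : rootDist w (Order.pred v) < n * (2 : ℝ) ^ k) (h2 : n * (2 : ℝ) ^ k ≤ rootDist w v) :
    CoversMultiple w (k + 1) v := by
  obtain ⟨m, rfl⟩ := hn
  have h : (m : ℝ) * 2 ^ (k + 1) = ((m + m : ℤ) : ℝ) * 2 ^ k := by
    rw [zpow_add₀ two_ne_zero]
    push_cast
    ring
  exact ⟨m, h ▸ h1, h ▸ h2⟩

/-- Every edge has a scale: the largest `k` such that its interval contains a multiple of `2 ^ k`. -/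
theorem exists_scale (hw : ∀ v : T, v ≠ ⊥ → 0 < w v) :
    ∃ r : T → ℤ, (∀ v, v ≠ ⊥ → (2 : ℝ) ^ r v ≤ rootDist w v ∧ w v < 2 ^ (r v + 1)) ∧
      ∀ a b, a ≠ ⊥ → a < b → r a = r b → ∃ c, a < c ∧ c < b ∧ r a < r c := by
  have key : ∀ v : T, v ≠ ⊥ →
      ∃ k, CoversMultiple w k v ∧ ∀ l, CoversMultiple w l v → l ≤ k := by
    intro v hv
    have hd : 0 < rootDist w v := by
      rw [← rootDist_bot w]
      exact rootDist_lt_of_lt hw (bot_lt_iff_ne_bot.2 hv)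
    -- A covered multiple is positive, which bounds the exponent by the logarithm of the depth; the
    -- logarithm of the weight is an admissible exponent.
    refine Int.exists_greatest_of_bdd ?_ ?_
    · refine ⟨Int.log 2 (rootDist w v), fun l hl => ?_⟩
      have := hl.zpow_le hw
      exact (Int.zpow_le_iff_le_log one_lt_two hd).1 (by exact_mod_cast this)
    · refine ⟨Int.log 2 (w v), coversMultiple_of_zpow_le hv ?_⟩
      exact_mod_cast Int.zpow_log_le_self one_lt_two (hw v hv)
  choose! r hr1 hr2 using key
  refine ⟨r, fun v hv => ⟨(hr1 v hv).zpow_le hw, ?_⟩, ?_⟩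
  · by_contra hcon
    have := hr2 v hv _ (coversMultiple_of_zpow_le hv (not_lt.1 hcon))
    omega
  · intro a b ha hab hr
    have hb : b ≠ ⊥ := (bot_le.trans_lt hab).ne'
    have hpos : (0 : ℝ) < 2 ^ r a := by positivity
    obtain ⟨n, hn1, hn2⟩ := hr1 a ha
    obtain ⟨m, hm1, hm2⟩ := hr1 b hb
    rw [← hr] at hm1 hm2
    have hno : ∀ c, c ≠ ⊥ → r c = r a → ¬ CoversMultiple w (r a + 1) c := by
      intro c hc hca h
      have := hr2 c hc _ h
      omega
    -- An even n would give a multiple of the next power of two, against maximality of the scale.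
    -- Hence the next multiple, with n + 1 even, separates `a` from `b`: it lies in neither
    -- interval, and the edge containing it has larger scale.
    have hodd : Odd n := by
      rw [← Int.not_even_iff_odd]
      exact fun h => hno a ha rfl (coversMultiple_succ_of_even h hn1 hn2)
    have hap : rootDist w a ≤ rootDist w (Order.pred b) :=
      rootDist_le_of_le hw (Order.le_pred_of_lt hab)
    have hnm : n < m := by
      have : (n : ℝ) * 2 ^ r a < m * 2 ^ r a := by linarith
      exact_mod_cast lt_of_mul_lt_mul_right this hpos.le
    have hnm' : ((n + 1 : ℤ) : ℝ) * 2 ^ r a ≤ m * 2 ^ r a := by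
      have : ((n + 1 : ℤ) : ℝ) ≤ m := by exact_mod_cast hnm
      exact mul_le_mul_of_nonneg_right this hpos.le
    have heven : Even (n + 1) := hodd.add_one
    have h1 : rootDist w a < ((n + 1 : ℤ) : ℝ) * 2 ^ r a := by
      by_contra h
      refine hno a ha rfl (coversMultiple_succ_of_even heven ?_ (not_lt.1 h))
      refine hn1.trans ?_
      push_cast
      linarith
    have h2 : ((n + 1 : ℤ) : ℝ) * 2 ^ r a ≤ rootDist w (Order.pred b) := by
      by_contra h
      exact hno b hb hr.symm (coversMultiple_succ_of_even heven (not_le.1 h) (hnm'.trans hm2))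
    obtain ⟨c, hcb, hc1, hc2⟩ :=
      exists_isLevelAncestor ((rootDist_nonneg hw a).trans_lt h1) h2
    have hcb' : c < b := hcb.trans_lt (Order.pred_lt_of_not_isMin (by simpa using hb))
    have hac : a < c := by
      have hle : a ≤ c ∨ c ≤ a := le_total_of_directed hcb'.le hab.le
      rcases hle with h | h
      · refine lt_of_le_of_ne h ?_
        rintro rfl
        linarith
      · have := rootDist_le_of_le hw h
        linarith
    have hc : c ≠ ⊥ := (bot_le.trans_lt hac).ne'
    have := hr2 c hc _ (coversMultiple_succ_of_even heven hc2 hc1)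
    exact ⟨c, hac, hcb', by omega⟩

end Distance

/-! ### Nearest ancestors of larger scale -/

section Spine

variable {T : RootedTree} [Fintype T]

/-- The nearest proper ancestor of larger rank, or the root. -/
theorem exists_nearest_larger (r : T → ℤ) :
    ∃ up : T → T, up ⊥ = ⊥ ∧ ∀ a, a ≠ ⊥ → up a < a ∧ (up a = ⊥ ∨ r a < r (up a)) ∧
      ∀ c, c < a → (c = ⊥ ∨ r a < r c) → c ≤ up a := by
  have key : ∀ a : T, ∃ b : T, (a = ⊥ → b = ⊥) ∧ (a ≠ ⊥ → b < a ∧ (b = ⊥ ∨ r a < r b) ∧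
      ∀ c, c < a → (c = ⊥ ∨ r a < r c) → c ≤ b) := by
    intro a
    by_cases ha : a = ⊥
    · exact ⟨⊥, fun _ => rfl, fun h => absurd ha h⟩
    · obtain ⟨b, hb⟩ := (Set.toFinite {c : T | c < a ∧ (c = ⊥ ∨ r a < r c)}).exists_maximal
        ⟨⊥, bot_lt_iff_ne_bot.2 ha, Or.inl rfl⟩
      refine ⟨b, fun h => absurd h ha, fun _ => ⟨hb.1.1, hb.1.2, fun c hc hcr => ?_⟩⟩
      have hle : c ≤ b ∨ b ≤ c := le_total_of_directed hb.1.1.le hc.le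
      rcases hle with h | h
      · exact h
      · exact hb.2 ⟨hc, hcr⟩ h
  choose up h1 h2 using key
  exact ⟨up, h1 ⊥ rfl, h2⟩

/-- A spine cannot jump over `c`: from any node of the spine below `c`, the node `c` is itself a
candidate for the nearest larger ancestor. -/
theorem exists_iterate_nearest_larger {r : T → ℤ} {up : T → T}
    (hup : ∀ a, a ≠ ⊥ → up a < a ∧ (up a = ⊥ ∨ r a < r (up a)) ∧
      ∀ c, c < a → (c = ⊥ ∨ r a < r c) → c ≤ up a)
    {c y : T} (hcy : c ≤ y) (hc : c = ⊥ ∨ ∀ e, c < e → e ≤ y → r e < r c) :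
    ∃ K, up^[K] y = c ∧ ∀ k < K, c < up^[k] y := by
  induction y using WellFoundedLT.induction with
  | ind y ih =>
    rcases hcy.eq_or_lt with rfl | hlt
    · exact ⟨0, rfl, by simp⟩
    · obtain ⟨h1, -, h3⟩ := hup y (bot_le.trans_lt hlt).ne'
      have hcu : c ≤ up y := h3 c hlt (hc.imp_right fun h => h y hlt le_rfl)
      obtain ⟨K, hK1, hK2⟩ := ih (up y) h1 hcu
        (hc.imp_right fun h e he hey => h e he (hey.trans h1.le))
      refine ⟨K + 1, hK1, fun k hk => ?_⟩
      cases k with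
      | zero => exact hlt
      | succ k => exact hK2 k (by omega)

end Spine

end WeightedTree

namespace WeightedTree

/-! ### Long-path decomposition and ladders -/

section Ladder

variable {α : Type*} [PartialOrder α] [OrderBot α] [Fintype α] {up : α → α}

/-- Heights in the forest of `up`-pointers, together with a child of maximal height for every inner node. -/
theorem exists_height (hup : ∀ a, a ≠ ⊥ → up a < a) :
    ∃ (h : α → ℕ) (long : α → α), (∀ c, c ≠ ⊥ → h c + 1 ≤ h (up c)) ∧
      ∀ z, 0 < h z → up (long z) = z ∧ long z ≠ ⊥ ∧ h (long z) + 1 = h z := by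
  classical
  have wf : WellFounded ((· > ·) : α → α → Prop) := wellFounded_gt
  let F : (z : α) → ((y : α) → y > z → ℕ) → ℕ := fun z ih =>
    Finset.univ.sup fun c => if hc : z < c ∧ up c = z then ih c hc.1 + 1 else 0
  let h : α → ℕ := wf.fix F
  have hh : ∀ z, h z = Finset.univ.sup fun c => if z < c ∧ up c = z then h c + 1 else 0 := by
    intro z
    have := wf.fix_eq F z
    simpa [F] using this
  have key : ∀ z, ∃ c, 0 < h z → up c = z ∧ c ≠ ⊥ ∧ h c + 1 = h z := by
    intro z
    obtain ⟨c, -, hc⟩ := Finset.exists_mem_eq_sup Finset.univ ⟨z, Finset.mem_univ z⟩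
      (fun c => if z < c ∧ up c = z then h c + 1 else 0)
    rw [← hh z] at hc
    refine ⟨c, fun hz => ?_⟩
    split_ifs at hc with hcz
    · exact ⟨hcz.2, (bot_le.trans_lt hcz.1).ne', hc.symm⟩
    · omega
  choose long hlong using key
  refine ⟨h, long, fun c hc => ?_, hlong⟩
  rw [hh (up c)]
  refine le_trans ?_ (Finset.le_sup (Finset.mem_univ c))
  simp [hup c hc]

/-- The ladder decomposition of the forest of `up`-pointers. Each element of `α ⊕ α` stands for an element of `α`,
and following `next` from a suitable one descends the lower half of any prescribed chain of `up`-pointers from its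
top to its middle. -/
theorem exists_ladder (hup : ∀ a, a ≠ ⊥ → up a < a) :
    ∃ (val : α ⊕ α → α) (next : α ⊕ α → α ⊕ α), (∀ c, val (Sum.inl c) = c) ∧
      ∀ y K, (∀ i < K, up^[i] y ≠ ⊥) →
        ∃ r, ∀ k ≤ K / 2, val (next^[k] r) = up^[K - k] y := by
  classical
  obtain ⟨h, long, hh, hlong⟩ := exists_height hup
  have wf : WellFounded ((· < ·) : α → α → Prop) := wellFounded_lt
  -- Position on the long path, counted from its top. The guard `up c < c` permits the recursion and
  -- makes `⊥` the top of its path.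
  let F : (z : α) → ((y : α) → y < z → ℕ) → ℕ := fun c ih =>
    if hc : up c < c ∧ long (up c) = c then ih (up c) hc.1 + 1 else 0
  let pos : α → ℕ := wf.fix F
  have hpos : ∀ c, pos c = if up c < c ∧ long (up c) = c then pos (up c) + 1 else 0 := by
    intro c
    have := wf.fix_eq F c
    simpa [F] using this
  have pos_long : ∀ c, 0 < h c → pos (long c) = pos c + 1 := by
    intro c hc
    obtain ⟨h1, h2, -⟩ := hlong c hc
    rw [hpos, h1, if_pos]
    have := hup _ h2
    rw [h1] at this
    exact ⟨this, rfl⟩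
  have pos_up : ∀ c, 0 < pos c → c ≠ ⊥ ∧ long (up c) = c ∧ pos c = pos (up c) + 1 := by
    intro c hc
    have h1 := hpos c
    split_ifs at h1 with h2
    · exact ⟨(bot_le.trans_lt h2.1).ne', h2.2, h1⟩
    · omega
  -- following `long` downwards
  have long_iter : ∀ m t, m ≤ h t → pos (long^[m] t) = pos t + m ∧ up^[m] (long^[m] t) = t ∧
      h (long^[m] t) + m = h t := by
    intro m
    induction m with
    | zero => simp
    | succ m ih =>
      intro t hm
      obtain ⟨i1, i2, i3⟩ := ih t (by omega)
      obtain ⟨j1, -, j3⟩ := hlong (long^[m] t) (by omega)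
      rw [Function.iterate_succ_apply' long, Function.iterate_succ_apply up, j1,
        pos_long _ (by omega)]
      exact ⟨by omega, i2, by omega⟩
  -- following `up` inside a long path
  have up_iter : ∀ m z, m ≤ pos z → pos (up^[m] z) + m = pos z ∧ long^[m] (up^[m] z) = z ∧
      h z + m ≤ h (up^[m] z) := by
    intro m
    induction m with
    | zero => simp
    | succ m ih =>
      intro z hm
      obtain ⟨i1, i2, i3⟩ := ih z (by omega)
      obtain ⟨j1, j2, j3⟩ := pos_up (up^[m] z) (by omega)
      have := hh _ j1
      rw [Function.iterate_succ_apply' up, Function.iterate_succ_apply long, j2]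
      exact ⟨by omega, i2, by omega⟩
  -- `inr c` is the reflection of `c` in the top of its long path: it stands for the ancestor as far
  -- above the top as `c` is below. Moving `c` up thus moves the represented node down; at the top
  -- the ladder passes to the path itself.
  let val : α ⊕ α → α := Sum.elim id fun c => up^[2 * pos c] c
  let next : α ⊕ α → α ⊕ α := Sum.elim (fun c => Sum.inl (long c))
    fun c => if pos c = 0 then Sum.inl (long c) else Sum.inr (up c)
  have next_inl : ∀ k c, next^[k] (Sum.inl c) = Sum.inl (long^[k] c) := by
    intro k
    induction k with
    | zero => simp
    | succ k ih => intro c; rw [Function.iterate_succ_apply, Function.iterate_succ_apply]; exact ih _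
  have next_inr : ∀ k c, k ≤ pos c → next^[k] (Sum.inr c) = Sum.inr (up^[k] c) := by
    intro k
    induction k with
    | zero => simp
    | succ k ih =>
      intro c hk
      have h1 : next (Sum.inr c) = Sum.inr (up c) := by
        simp only [next, Sum.elim_inr]
        rw [if_neg (by omega)]
      rw [Function.iterate_succ_apply, Function.iterate_succ_apply, h1]
      exact ih _ (by have := (pos_up c (by omega)).2.2; omega)
  have next_top : ∀ k c, pos c = 0 → val (next^[k] (Sum.inr c)) = long^[k] c := by
    intro k c hc
    cases k with
    | zero => simp [val, hc]
    | succ k =>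
      have h1 : next (Sum.inr c) = Sum.inl (long c) := by
        simp only [next, Sum.elim_inr]
        rw [if_pos hc]
      rw [Function.iterate_succ_apply, h1, next_inl, Function.iterate_succ_apply]
      rfl
  -- descending to a node `z` of height at least `m` from its `m`-th ancestor
  have descend : ∀ z m, m ≤ h z → ∃ r, ∀ k ≤ m, val (next^[k] r) = up^[m - k] z := by
    intro z m hm
    rcases le_or_gt m (pos z) with hmp | hmp
    · refine ⟨Sum.inl (up^[m] z), fun k hk => ?_⟩
      obtain ⟨i1, -, -⟩ := up_iter (m - k) z (by omega)
      obtain ⟨-, j2, -⟩ := up_iter k (up^[m - k] z) (by omega)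
      rw [← Function.iterate_add_apply, show k + (m - k) = m by omega] at j2
      rw [next_inl, j2]
      rfl
    · obtain ⟨t1, t2, t3⟩ := up_iter (pos z) z le_rfl
      set t := up^[pos z] z with ht
      -- The target is `i` steps above the top `t`. As `t` has height at least `m`, its long path
      -- has a node at position `i`, whose reflection is the target.
      set i := m - pos z with hi
      obtain ⟨c1, c2, -⟩ := long_iter i t (by omega)
      set c := long^[i] t with hc
      refine ⟨Sum.inr c, fun k hk => ?_⟩
      rcases le_or_gt k i with hki | hki
      · have hp : pos (up^[k] c) + k = pos c := (up_iter k c (by omega)).1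
        rw [next_inr k c (by omega)]
        change up^[2 * pos (up^[k] c)] (up^[k] c) = _
        rw [← Function.iterate_add_apply,
          show 2 * pos (up^[k] c) + k = (i - k) + i by omega, Function.iterate_add_apply, c2, ht,
          ← Function.iterate_add_apply]
        congr 1
        omega
      · rw [show k = (k - i) + i by omega, Function.iterate_add_apply, next_inr i c (by omega), c2,
          next_top _ _ (by omega)]
        obtain ⟨i1, -, -⟩ := up_iter (pos z - (k - i)) z (by omega)
        obtain ⟨-, j2, -⟩ := up_iter (k - i) (up^[pos z - (k - i)] z) (by omega)
        rw [← Function.iterate_add_apply, show k - i + (pos z - (k - i)) = pos z by omega] at j2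
        rw [ht, j2]
        congr 1
        omega
  refine ⟨val, next, fun _ => rfl, fun y K hK => ?_⟩
  have hht : ∀ i ≤ K, i ≤ h (up^[i] y) := by
    intro i
    induction i with
    | zero => simp
    | succ i ih =>
      intro hi
      have := hh _ (hK i (by omega))
      have := ih (by omega)
      rw [Function.iterate_succ_apply']
      omega
  -- The midpoint has height at least K - K / 2, hence at least the K / 2 levels of ladder needed
  -- above it.
  obtain ⟨r, hr⟩ := descend (up^[K - K / 2] y) (K / 2) (by have := hht (K - K / 2) (by omega); omega)
  refine ⟨r, fun k hk => ?_⟩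
  rw [hr k hk, ← Function.iterate_add_apply]
  congr 1
  omega

end Ladder

end WeightedTree

namespace PointerMachine

/-! ### Composing executions -/

section Reaches

variable {p q : ℕ} {κ : Type*} {P : Program p q} {D : DataStructure p q κ}

/-- The program gets from `s` to `s'` in exactly `n` steps. -/
def Reaches (P : Program p q) (D : DataStructure p q κ) (s : Config κ) (n : ℕ) (s' : Config κ) : Prop :=
  ∀ t c, Run P D s' t c → Run P D s (t + n) c

theorem Reaches.refl (s : Config κ) : Reaches P D s 0 s := fun _ _ h => h

theorem Reaches.head {s s' s'' : Config κ} {n : ℕ} {i : Instr p q} (hi : P[s.pc]? = some i)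
    (hs : exec D s i = some s') (h : Reaches P D s' n s'') : Reaches P D s (n + 1) s'' :=
  fun t c hr => Run.step hi hs (h t c hr)

theorem Reaches.trans {s s' s'' : Config κ} {m n : ℕ} (h : Reaches P D s m s')
    (h' : Reaches P D s' n s'') : Reaches P D s (m + n) s'' := by
  intro t c hr
  have := h _ _ (h' t c hr)
  rwa [add_assoc, add_comm n m] at this

variable {pc dst src a b l n : ℕ} {ptr : ℕ → Option κ} {num : ℕ → ℝ} {s : Config κ}

theorem Reaches.loadPtr {f : Fin p} {c : κ} (hi : P[pc]? = some (.loadPtr dst src f))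
    (hc : ptr src = some c)
    (h : Reaches P D ⟨pc + 1, Function.update ptr dst (D.ptrField c f), num⟩ n s) :
    Reaches P D ⟨pc, ptr, num⟩ (n + 1) s :=
  Reaches.head hi (by simp [exec, hc]) h

theorem Reaches.loadNum {f : Fin q} {c : κ} (hi : P[pc]? = some (.loadNum dst src f))
    (hc : ptr src = some c)
    (h : Reaches P D ⟨pc + 1, ptr, Function.update num dst (D.numField c f)⟩ n s) :
    Reaches P D ⟨pc, ptr, num⟩ (n + 1) s :=
  Reaches.head hi (by simp [exec, hc]) h

theorem Reaches.movePtr (hi : P[pc]? = some (.movePtr dst src))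
    (h : Reaches P D ⟨pc + 1, Function.update ptr dst (ptr src), num⟩ n s) :
    Reaches P D ⟨pc, ptr, num⟩ (n + 1) s :=
  Reaches.head hi rfl h

theorem Reaches.ifLe_pos (hi : P[pc]? = some (.ifLe a b l)) (hab : num a ≤ num b)
    (h : Reaches P D ⟨l, ptr, num⟩ n s) : Reaches P D ⟨pc, ptr, num⟩ (n + 1) s :=
  Reaches.head hi (by simp [exec, hab]) h

theorem Reaches.ifLe_neg (hi : P[pc]? = some (.ifLe a b l)) (hab : num b < num a)
    (h : Reaches P D ⟨pc + 1, ptr, num⟩ n s) : Reaches P D ⟨pc, ptr, num⟩ (n + 1) s :=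
  Reaches.head hi (by simp [exec, hab.not_ge]) h

theorem Reaches.goto (hi : P[pc]? = some (.goto l)) (h : Reaches P D ⟨l, ptr, num⟩ n s) :
    Reaches P D ⟨pc, ptr, num⟩ (n + 1) s :=
  Reaches.head hi rfl h

end Reaches

end PointerMachine

/-! ### The query program and its two inner loops -/

namespace WeightedTree

/-- The query program. Pointer registers: `0` the current node, `1` the position on a ladder, `2` the middle of the
current finger. Instructions `4`-`9` climb, `10`-`14` descend a ladder, `15`-`21` test a candidate. -/
def queryProgram : Program 8 2 :=
  [.loadPtr 1 0 6, .loadPtr 2 0 7,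
   .loadNum 1 2 0, .ifLe 0 1 10,
   .loadPtr 3 0 2, .loadNum 1 3 0, .ifLe 0 1 8, .goto 15, .movePtr 0 3, .goto 4,
   .loadPtr 1 1 0, .loadNum 1 1 0, .ifLe 0 1 14, .goto 10, .loadPtr 0 1 1,
   .loadNum 1 0 1, .ifLe 0 1 18, .ret 0,
   .loadPtr 1 0 3, .loadPtr 2 0 4, .loadPtr 0 0 5, .goto 2]

/-- What the records are built from. The record `c` represents the node `val c` and is followed by `next c` on its
ladder. A node `v` has the depth `d v`, the parent `par v`, the nearest ancestor `up v` of larger scale, the finger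
`(start v, mid v)` for the search between `up v` and `par v`, and the finger `(start₀ v, mid₀ v)` for the search
between the root and `v`. -/
structure Index (α : Type*) where
  (val : α ⊕ α → α) (next : α ⊕ α → α ⊕ α)
  (up par : α → α)
  (start start₀ : α → α ⊕ α)
  (mid mid₀ : α → α)
  (d : α → ℝ)

namespace Index

variable {α : Type*} (S : Index α)

/-- The pointer machine data structure of an index. -/
def data : DataStructure 8 2 (α ⊕ α) where
  ptrField c f := some (![S.next c, Sum.inl (S.val c), Sum.inl (S.up (S.val c)), S.start (S.val c),
    Sum.inl (S.mid (S.val c)), Sum.inl (S.par (S.val c)), S.start₀ (S.val c),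
    Sum.inl (S.mid₀ (S.val c))] f)
  numField c f := ![S.d (S.val c), S.d (S.par (S.val c))] f

theorem reaches_climb (hval : ∀ c, S.val (Sum.inl c) = c) {x : ℝ} (e : ℕ) :
    ∀ (y : α) (ptr : ℕ → Option (α ⊕ α)) (num : ℕ → ℝ), ptr 0 = some (Sum.inl y) → num 0 = x →
      (∀ i < e, x ≤ S.d (S.up^[i + 1] y)) → S.d (S.up^[e + 1] y) < x →
      ∃ ptr' num', Reaches queryProgram S.data ⟨4, ptr, num⟩ (5 * e + 4) ⟨15, ptr', num'⟩ ∧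
        ptr' 0 = some (Sum.inl (S.up^[e] y)) ∧ num' 0 = x := by
  induction e with
  | zero =>
    intro y ptr num hp hn _ hlt
    have hr : Reaches queryProgram S.data ⟨4, ptr, num⟩ 4
        ⟨15, Function.update ptr 3 (some (Sum.inl (S.up y))), Function.update num 1 (S.d (S.up y))⟩ := by
      refine .loadPtr rfl hp <| .loadNum (c := Sum.inl (S.up y)) rfl ?_ <| .ifLe_neg rfl ?_ <|
        .goto rfl ?_
      · simp [data, hval]
      · simpa [data, hn, hval] using hlt
      · simpa [data, hval] using Reaches.refl _
    exact ⟨_, _, hr, by simpa using hp, by simpa using hn⟩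
  | succ e ih =>
    intro y ptr num hp hn hle hlt
    have hr : Reaches queryProgram S.data ⟨4, ptr, num⟩ 5
        ⟨4, Function.update (Function.update ptr 3 (some (Sum.inl (S.up y)))) 0
          (some (Sum.inl (S.up y))), Function.update num 1 (S.d (S.up y))⟩ := by
      refine .loadPtr rfl hp <| .loadNum (c := Sum.inl (S.up y)) rfl ?_ <| .ifLe_pos rfl ?_ <|
        .movePtr rfl <| .goto rfl ?_
      · simp [data, hval]
      · simpa [data, hn, hval] using hle 0 (by omega)
      · simpa [data, hval] using Reaches.refl _
    obtain ⟨ptr', num', h1, h2, h3⟩ := ih (S.up y)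
      (Function.update (Function.update ptr 3 (some (Sum.inl (S.up y)))) 0 (some (Sum.inl (S.up y))))
      (Function.update num 1 (S.d (S.up y))) (Function.update_self ..)
      (by simpa using hn) (fun i hi => hle (i + 1) (by omega)) hlt
    exact ⟨ptr', num', by simpa only [add_comm, add_left_comm, mul_add, mul_one] using hr.trans h1, h2, h3⟩

/-- Scanning tests `next r` first, because the start of the ladder stands for the upper end, already
known to be too shallow. The last load replaces the ladder record by the node's own record. -/
theorem reaches_scan {x : ℝ} (j : ℕ) :
    ∀ (r : α ⊕ α) (ptr : ℕ → Option (α ⊕ α)) (num : ℕ → ℝ), ptr 1 = some r → num 0 = x →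
      (∀ i < j, S.d (S.val (S.next^[i + 1] r)) < x) → x ≤ S.d (S.val (S.next^[j + 1] r)) →
      ∃ ptr' num', Reaches queryProgram S.data ⟨10, ptr, num⟩ (4 * j + 4) ⟨15, ptr', num'⟩ ∧
        ptr' 0 = some (Sum.inl (S.val (S.next^[j + 1] r))) ∧ num' 0 = x := by
  induction j with
  | zero =>
    intro r ptr num hp hn _ hle
    have hr : Reaches queryProgram S.data ⟨10, ptr, num⟩ 4
        ⟨15, Function.update (Function.update ptr 1 (some (S.next r))) 0
          (some (Sum.inl (S.val (S.next r)))), Function.update num 1 (S.d (S.val (S.next r)))⟩ := by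
      refine .loadPtr rfl hp <| .loadNum (c := S.next r) rfl ?_ <| .ifLe_pos rfl ?_ <|
        .loadPtr (c := S.next r) rfl ?_ ?_
      · simp [data]
      · simpa [data, hn] using hle
      · simp [data]
      · simpa [data] using Reaches.refl _
    exact ⟨_, _, hr, by simp, by simpa using hn⟩
  | succ j ih =>
    intro r ptr num hp hn hlt hle
    have hr : Reaches queryProgram S.data ⟨10, ptr, num⟩ 4
        ⟨10, Function.update ptr 1 (some (S.next r)),
          Function.update num 1 (S.d (S.val (S.next r)))⟩ := by
      refine .loadPtr rfl hp <| .loadNum (c := S.next r) rfl ?_ <| .ifLe_neg rfl ?_ <| .goto rfl ?_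
      · simp [data]
      · simpa [data, hn] using hlt 0 (by omega)
      · simpa [data] using Reaches.refl _
    obtain ⟨ptr', num', h1, h2, h3⟩ := ih (S.next r)
      (Function.update ptr 1 (some (S.next r))) (Function.update num 1 (S.d (S.val (S.next r))))
      (Function.update_self ..)
      (by simpa using hn) (fun i hi => hlt (i + 1) (by omega)) hle
    exact ⟨ptr', num', by simpa only [add_comm, add_left_comm, mul_add, mul_one] using hr.trans h1, h2, h3⟩

end Index
end WeightedTree
namespace WeightedTree
namespace Index

/-! ### Finger searches -/

section Finger

variable {α : Type*} (S : Index α)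

/-- `s` and `m` make it possible to search between `b` and `y`, where `b` lies on the spine of `y`: `m` is in the
middle and the ladder starting at `s` descends from `b` to `m`. -/
def IsFinger [PartialOrder α] (b y : α) (s : α ⊕ α) (m : α) : Prop :=
  ∃ K, S.up^[K] y = b ∧ (∀ k < K, b < S.up^[k] y) ∧
    (∀ k ≤ K / 2, S.val (S.next^[k] s) = S.up^[K - k] y) ∧ m = S.up^[K - K / 2] y

/-- A finger search takes time proportional to the distance from the upper end. -/
theorem reaches_finger_search (hval : ∀ c, S.val (Sum.inl c) = c) (hd : ∀ a, S.d (S.up a) ≤ S.d a)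
    {x : ℝ} {y : α} {K : ℕ} {s : α ⊕ α} {ptr : ℕ → Option (α ⊕ α)} {num : ℕ → ℝ}
    (hs : ∀ k ≤ K / 2, S.val (S.next^[k] s) = S.up^[K - k] y)
    (hb : S.d (S.up^[K] y) < x) (hy : x ≤ S.d y)
    (h0 : ptr 0 = some (Sum.inl y)) (h1 : ptr 1 = some s)
    (h2 : ptr 2 = some (Sum.inl (S.up^[K - K / 2] y))) (hn : num 0 = x) :
    ∃ j n ptr' num', 1 ≤ j ∧ j ≤ K ∧ n ≤ 6 * j + 6 ∧
      x ≤ S.d (S.up^[K - j] y) ∧ S.d (S.up^[K - j + 1] y) < x ∧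
      Reaches queryProgram S.data ⟨2, ptr, num⟩ n ⟨15, ptr', num'⟩ ∧
      ptr' 0 = some (Sum.inl (S.up^[K - j] y)) ∧ num' 0 = x := by
  classical
  have hanti : Antitone fun i => S.d (S.up^[i] y) :=
    antitone_nat_of_succ_le fun i => by rw [Function.iterate_succ_apply']; exact hd _
  -- Here `j` counts spine steps down from the upper end.
  have hex : ∃ j, x ≤ S.d (S.up^[K - j] y) := ⟨K, by simpa using hy⟩
  obtain ⟨j, hj, hmin⟩ : ∃ j, x ≤ S.d (S.up^[K - j] y) ∧ ∀ i < j, S.d (S.up^[K - i] y) < x :=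
    ⟨Nat.find hex, Nat.find_spec hex, fun i hi => not_le.1 (Nat.find_min hex hi)⟩
  have hj1 : 1 ≤ j := by
    by_contra h
    obtain rfl : j = 0 := by omega
    exact absurd hj (by simpa using hb)
  have hjK : j ≤ K := by
    by_contra h
    have := hmin K (by omega)
    rw [Nat.sub_self] at this
    exact absurd hy (by simpa using this)
  have hlt : S.d (S.up^[K - j + 1] y) < x := by
    have := hmin (j - 1) (by omega)
    rwa [show K - (j - 1) = K - j + 1 by omega] at this
  have hload : ∀ n s', Reaches queryProgram S.data
      ⟨3, ptr, Function.update num 1 (S.d (S.up^[K - K / 2] y))⟩ n s' →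
      Reaches queryProgram S.data ⟨2, ptr, num⟩ (n + 1) s' := by
    intro n s' h
    refine .loadNum rfl h2 ?_
    simpa [data, hval] using h
  have hn' : Function.update num 1 (S.d (S.up^[K - K / 2] y)) 0 = x := by simpa using hn
  -- Comparing x with the depth of the midpoint decides this case split. In the second case K - j <
  -- j, so climbing from below is also O(j).
  rcases le_or_gt j (K / 2) with hjm | hjm
  · have hm : x ≤ S.d (S.up^[K - K / 2] y) := hj.trans (hanti (by omega))
    obtain ⟨ptr', num', r1, r2, r3⟩ := S.reaches_scan (x := x) (j - 1) s ptr _ h1 hn'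
      (fun i hi => by rw [hs _ (by omega)]; exact hmin _ (by omega))
      (by rw [hs _ (by omega), Nat.sub_add_cancel hj1]; exact hj)
    rw [hs _ (by omega), Nat.sub_add_cancel hj1] at r2
    refine ⟨j, _, ptr', num', hj1, hjK, ?_, hj, hlt, hload _ _ (.ifLe_pos rfl ?_ r1), r2, r3⟩
    · omega
    · simpa [hn] using hm
  · have hm : S.d (S.up^[K - K / 2] y) < x := hmin _ hjm
    obtain ⟨ptr', num', r1, r2, r3⟩ := S.reaches_climb hval (x := x) (K - j) y ptr _ h0 hn'
      (fun i hi => hj.trans (hanti (by omega))) hlt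
    refine ⟨j, _, ptr', num', hj1, hjK, ?_, hj, hlt, hload _ _ (.ifLe_neg rfl ?_ r1), r2, r3⟩
    · omega
    · simpa [hn] using hm

theorem run_test (hval : ∀ c, S.val (Sum.inl c) = c) {a : α} {ptr : ℕ → Option (α ⊕ α)} {num : ℕ → ℝ}
    (h0 : ptr 0 = some (Sum.inl a)) (ha : S.d (S.par a) < num 0) :
    Run queryProgram S.data ⟨15, ptr, num⟩ 3 (Sum.inl a) := by
  have hr : Reaches queryProgram S.data ⟨15, ptr, num⟩ 2
      ⟨17, ptr, Function.update num 1 (S.d (S.par a))⟩ := by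
    refine .loadNum rfl h0 <| .ifLe_neg rfl ?_ ?_
    · simpa [data, hval] using ha
    · simpa [data, hval] using Reaches.refl _
  exact hr 1 _ (Run.ret rfl h0)

theorem reaches_next_finger (hval : ∀ c, S.val (Sum.inl c) = c) {a : α} {ptr : ℕ → Option (α ⊕ α)}
    {num : ℕ → ℝ} (h0 : ptr 0 = some (Sum.inl a)) (ha : num 0 ≤ S.d (S.par a)) :
    ∃ ptr' num', Reaches queryProgram S.data ⟨15, ptr, num⟩ 6 ⟨2, ptr', num'⟩ ∧
      ptr' 0 = some (Sum.inl (S.par a)) ∧ ptr' 1 = some (S.start a) ∧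
      ptr' 2 = some (Sum.inl (S.mid a)) ∧ num' 0 = num 0 := by
  have hr : Reaches queryProgram S.data ⟨15, ptr, num⟩ 6
      ⟨2, Function.update (Function.update (Function.update ptr 1 (some (S.start a))) 2
        (some (Sum.inl (S.mid a)))) 0 (some (Sum.inl (S.par a))),
        Function.update num 1 (S.d (S.par a))⟩ := by
    refine .loadNum rfl h0 <| .ifLe_pos rfl ?_ <| .loadPtr rfl h0 <|
      .loadPtr (c := Sum.inl a) rfl ?_ <| .loadPtr (c := Sum.inl a) rfl ?_ <| .goto rfl ?_
    · simpa [data, hval] using ha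
    · simpa using h0
    · simpa using h0
    · simpa [data, hval] using Reaches.refl _
  exact ⟨_, _, hr, by simp, by simp, by simp, by simp⟩

theorem reaches_first_finger (hval : ∀ c, S.val (Sum.inl c) = c) {a : α} {ptr : ℕ → Option (α ⊕ α)}
    (num : ℕ → ℝ) (h0 : ptr 0 = some (Sum.inl a)) :
    ∃ ptr', Reaches queryProgram S.data ⟨0, ptr, num⟩ 2 ⟨2, ptr', num⟩ ∧
      ptr' 0 = some (Sum.inl a) ∧ ptr' 1 = some (S.start₀ a) ∧ ptr' 2 = some (Sum.inl (S.mid₀ a)) := by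
  have hr : Reaches queryProgram S.data ⟨0, ptr, num⟩ 2
      ⟨2, Function.update (Function.update ptr 1 (some (S.start₀ a))) 2
        (some (Sum.inl (S.mid₀ a))), num⟩ := by
    refine .loadPtr rfl h0 <| .loadPtr (c := Sum.inl a) rfl ?_ ?_
    · simpa using h0
    · simpa [data, hval] using Reaches.refl _
  exact ⟨_, hr, by simpa using h0, by simp, by simp⟩

end Finger

/-! ### Amortisation of the main loop -/

section Loop

variable {T : RootedTree} [Fintype T] {w : T → ℝ} {S : Index T} {r : T → ℤ}

/-- The main loop: every finger search lowers the scale by at least the distance it covers. -/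
theorem exists_run_loop (hw : ∀ v : T, v ≠ ⊥ → 0 < w v) (hval : ∀ c, S.val (Sum.inl c) = c)
    (hd : S.d = rootDist w) (hpar : S.par = Order.pred) (hup0 : S.up ⊥ = ⊥)
    (hup : ∀ a, a ≠ ⊥ → S.up a < a ∧ (S.up a = ⊥ ∨ r a < r (S.up a)))
    (hr : ∀ a c, S.up a < c → c < a → r c < r a)
    (hfinger : ∀ a, a ≠ ⊥ → S.IsFinger (S.up a) (Order.pred a) (S.start a) (S.mid a))
    {x : ℝ} (y : T) :
    ∀ (b : T) (s : T ⊕ T) (m : T) (ρ : ℤ) (ptr : ℕ → Option (T ⊕ T)) (num : ℕ → ℝ),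
      S.IsFinger b y s m → rootDist w b < x → x ≤ rootDist w y →
      (∀ a, b < a → a ≤ y → r a ≤ ρ) →
      ptr 0 = some (Sum.inl y) → ptr 1 = some s → ptr 2 = some (Sum.inl m) → num 0 = x →
      ∃ v t, v ≠ ⊥ ∧ IsLevelAncestor w y x v ∧
        Run queryProgram S.data ⟨2, ptr, num⟩ t (Sum.inl v) ∧ (t : ℤ) ≤ 18 * (ρ - r v + 1) := by
  have hle : ∀ a, S.up a ≤ a := fun a => by
    by_cases h : a = ⊥
    · rw [h, hup0]
    · exact (hup a h).1.le
  induction y using WellFoundedLT.induction with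
  | ind y ih =>
    rintro b s m ρ ptr num ⟨K, hK1, hK2, hK3, rfl⟩ hb hy hρ h0 h1 h2 hn
    obtain ⟨j, n, ptr', num', hj1, hjK, hnj, hxa, hax, hreach, p0, n0⟩ :=
      S.reaches_finger_search hval (fun a => by rw [hd]; exact rootDist_le_of_le hw (hle a)) hK3
        (by rwa [hd, hK1]) (by rwa [hd]) h0 h1 h2 hn
    -- Scales increase strictly up the spine, so each step down from the top loses at least one.
    have hrank : ∀ j, 1 ≤ j → j ≤ K → r (S.up^[K - j] y) + (j - 1) ≤ ρ := by
      intro j hj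
      induction j, hj using Nat.le_induction with
      | base =>
        intro hjK
        have := hρ _ (hK2 (K - 1) (by omega)) (Function.iterate_le_id_of_le_id hle _ _)
        simpa using this
      | succ j hj ihj =>
        intro hjK
        have h3 := ihj (by omega)
        have h4 := hK2 (K - j) (by omega)
        have h5 := hK2 (K - (j + 1)) (by omega)
        rw [show K - j = K - (j + 1) + 1 by omega, Function.iterate_succ_apply'] at h3 h4
        have := (hup _ (bot_le.trans_lt h5).ne').2.resolve_left (bot_le.trans_lt h4).ne'
        push_cast
        omega
    have hra := hrank j hj1 hjK
    have hba := hK2 (K - j) (by omega)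
    have hay : S.up^[K - j] y ≤ y := Function.iterate_le_id_of_le_id hle _ _
    rw [Function.iterate_succ_apply'] at hax
    rw [hd] at hxa hax
    generalize S.up^[K - j] y = a at *
    have ha : a ≠ ⊥ := (bot_le.trans_lt hba).ne'
    have hlt : Order.pred a < a := Order.pred_lt_of_not_isMin (by simpa using ha)
    rcases lt_or_ge (rootDist w (Order.pred a)) x with hpa | hpa
    · refine ⟨a, 3 + n, ha, ⟨hay, hxa, hpa⟩, hreach _ _ (S.run_test hval p0 ?_), ?_⟩
      · rwa [hd, hpar, n0]
      · push_cast
        omega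
    · obtain ⟨ptr'', num'', hreach', q0, q1, q2, qn⟩ := S.reaches_next_finger hval p0
        (num := num') (by rwa [hd, hpar, n0])
      rw [hpar] at q0
      obtain ⟨v, t, hv, hva, hrun, ht⟩ := ih _ (hlt.trans_le hay) (S.up a) (S.start a) (S.mid a)
        (r a - 1) ptr'' num'' (hfinger a ha) hax hpa
        (fun c hc hca => by have := hr a c hc (hca.trans_lt hlt); omega) q0 q1 q2 (qn.trans n0)
      -- One round costs at most 6j + 12 ≤ 18j, and the new scale bound `r a - 1` is at least j
      -- below `ρ`.
      refine ⟨v, t + (n + 6), hv, ⟨hva.1.trans (hlt.le.trans hay), hva.2⟩,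
        (hreach.trans hreach') _ _ hrun, ?_⟩
      push_cast
      omega

end Loop

/-- Every edge-weighted rooted tree has an index, with fingers for all searches that occur. -/
theorem exists_index {T : RootedTree} [Fintype T] {w : T → ℝ} {r : T → ℤ}
    (hr : ∀ a b : T, a ≠ ⊥ → a < b → r a = r b → ∃ c, a < c ∧ c < b ∧ r a < r c) :
    ∃ S : Index T, (∀ c, S.val (Sum.inl c) = c) ∧ S.d = rootDist w ∧ S.par = Order.pred ∧ S.up ⊥ = ⊥ ∧
      (∀ a, a ≠ ⊥ → S.up a < a ∧ (S.up a = ⊥ ∨ r a < r (S.up a))) ∧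
      (∀ a c, S.up a < c → c < a → r c < r a) ∧
      (∀ a, a ≠ ⊥ → S.IsFinger (S.up a) (Order.pred a) (S.start a) (S.mid a)) ∧
      ∀ a, S.IsFinger ⊥ a (S.start₀ a) (S.mid₀ a) := by
  obtain ⟨up, hup0, hup⟩ := exists_nearest_larger r
  obtain ⟨val, next, hval, hladder⟩ := exists_ladder fun a ha => (hup a ha).1
  have hrank : ∀ a c, up a < c → c < a → r c < r a := by
    intro a c hc hca
    have ha : a ≠ ⊥ := (bot_le.trans_lt hca).ne'
    have hle : ∀ e, up a < e → e < a → r e ≤ r a := fun e he hea =>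
      not_lt.1 fun h => he.not_ge ((hup a ha).2.2 e hea (Or.inr h))
    -- Equal scales would force a larger one strictly between `c` and `a`, contradicting that `up a`
    -- is nearest.
    refine lt_of_le_of_ne (hle c hc hca) fun heq => ?_
    obtain ⟨e, he1, he2, he3⟩ := hr c a (bot_le.trans_lt hc).ne' hca heq
    have := hle e (hc.trans he1) he2
    omega
  have key : ∀ b y : T, b ≤ y → (b = ⊥ ∨ ∀ e, b < e → e ≤ y → r e < r b) →
      ∃ s m, ∃ K, up^[K] y = b ∧ (∀ k < K, b < up^[k] y) ∧
        (∀ k ≤ K / 2, val (next^[k] s) = up^[K - k] y) ∧ m = up^[K - K / 2] y := by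
    intro b y hby h
    obtain ⟨K, hK1, hK2⟩ := exists_iterate_nearest_larger hup hby h
    obtain ⟨s, hs⟩ := hladder y K fun i hi => (bot_le.trans_lt (hK2 i hi)).ne'
    exact ⟨s, _, K, hK1, hK2, hs, rfl⟩
  have key1 : ∀ a : T, a ≠ ⊥ → ∃ s m, ∃ K, up^[K] (Order.pred a) = up a ∧
      (∀ k < K, up a < up^[k] (Order.pred a)) ∧
        (∀ k ≤ K / 2, val (next^[k] s) = up^[K - k] (Order.pred a)) ∧
          m = up^[K - K / 2] (Order.pred a) := by
    intro a ha
    have hlt : Order.pred a < a := Order.pred_lt_of_not_isMin (by simpa using ha)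
    exact key _ _ (Order.le_pred_of_lt (hup a ha).1) ((hup a ha).2.1.imp_right fun h e he hea =>
      (hrank a e he (hea.trans_lt hlt)).trans h)
  have key0 := fun a : T => key ⊥ a bot_le (Or.inl rfl)
  -- The root gets an arbitrary default finger.
  have : Inhabited T := ⟨⊥⟩
  choose! start mid h1 using key1
  choose start₀ mid₀ h0 using key0
  exact ⟨⟨val, next, up, Order.pred, start, start₀, mid, mid₀, rootDist w⟩, hval, rfl, rfl, hup0,
    fun a ha => ⟨(hup a ha).1, (hup a ha).2.1⟩, hrank, h1, h0⟩

end Index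
end WeightedTree

/-! ### Assembly and the logarithmic bound -/

theorem mainTheorem4 :
    ∃ (p q : ℕ) (P : Program p q) (C : ℕ),
      ∀ (T : RootedTree.{u}) [Fintype T] (w : T → ℝ), (∀ v : T, v ≠ ⊥ → 0 < w v) →
        ∃ (κ : Type u) (_ : Fintype κ) (D : DataStructure p q κ) (node : T → κ),
          -- linear space
          Fintype.card κ ≤ C * Fintype.card T ∧
          -- each node of the tree has its own record
          Function.Injective node ∧
          -- word size: the stored numbers are distances of nodes from the root
          (∀ (c : κ) (f : Fin q), ∃ v : T, D.numField c f = rootDist w v) ∧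
          -- correctness and query time
          ∀ (u : T) (x : ℝ), u ≠ ⊥ → 0 < x → x ≤ rootDist w u →
            ∃ (v : T) (t : ℕ), IsLevelAncestor w u x v ∧
              Run P D (Config.init (node u) x) t (node v) ∧
              (t : ℝ) ≤ C * (1 + Real.logb 2
                (rootDist w u / (rootDist w v - rootDist w (Order.pred v)))) := by
  -- With L the logarithm of d(u)/w(v), the loop costs at most 18(L + 2) and the start 2, so the
  -- total is at most 18L + 38; L ≥ 0 gives 38(1 + L).
  refine ⟨8, 2, queryProgram, 38, fun T _ w hw => ?_⟩
  obtain ⟨r, hr1, hr2⟩ := exists_scale hw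
  obtain ⟨S, hval, hd, hpar, hup0, hup, hr, hfinger, hfinger₀⟩ := Index.exists_index (w := w) hr2
  refine ⟨T ⊕ T, inferInstance, S.data, Sum.inl, ?_, Sum.inl_injective, ?_, ?_⟩
  · rw [Fintype.card_sum]
    omega
  · intro c f
    fin_cases f
    · exact ⟨S.val c, by simp [Index.data, hd]⟩
    · exact ⟨Order.pred (S.val c), by simp [Index.data, hd, hpar]⟩
  · intro u x hu hx hxu
    have hdu : 0 < rootDist w u := hx.trans_le hxu
    have hρ : ∀ a, ⊥ < a → a ≤ u → r a ≤ Int.log 2 (rootDist w u) := by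
      intro a ha hau
      refine (Int.zpow_le_iff_le_log one_lt_two hdu).1 ?_
      exact_mod_cast (hr1 a ha.ne').1.trans (rootDist_le_of_le hw hau)
    obtain ⟨ptr, hstart, p0, p1, p2⟩ := S.reaches_first_finger hval
      (ptr := (Config.init (Sum.inl u : T ⊕ T) x).ptr) (Config.init (Sum.inl u : T ⊕ T) x).num rfl
    obtain ⟨v, t, hv, hva, hrun, ht⟩ := Index.exists_run_loop hw hval hd hpar hup0 hup hr hfinger u ⊥
      (S.start₀ u) (S.mid₀ u) _ ptr (Config.init (Sum.inl u : T ⊕ T) x).num (hfinger₀ u) (by rwa [rootDist_bot]) hxu hρ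
      p0 p1 p2 rfl
    refine ⟨v, t + 2, hva, hstart _ _ hrun, ?_⟩
    have hwv := hw v hv
    rw [rootDist_eq w hv, add_sub_cancel_left, Real.logb_div hdu.ne' hwv.ne']
    have hwu : w v ≤ rootDist w u := by
      have h1 := rootDist_le_of_le hw hva.1
      have h2 := rootDist_nonneg hw (Order.pred v)
      rw [rootDist_eq w hv] at h1
      linarith
    have hlog : Real.logb 2 (w v) ≤ Real.logb 2 (rootDist w u) :=
      Real.logb_le_logb_of_le one_lt_two hwv hwu
    have hv1 : Real.logb 2 (w v) ≤ r v + 1 := by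
      rw [Real.logb_le_iff_le_rpow one_lt_two hwv]
      exact_mod_cast (hr1 v hv).2.le
    have hu1 : (Int.log 2 (rootDist w u) : ℝ) ≤ Real.logb 2 (rootDist w u) := by
      rw [Real.le_logb_iff_rpow_le one_lt_two hdu, Real.rpow_intCast]
      exact_mod_cast Int.zpow_log_le_self one_lt_two hdu
    have ht' : (t : ℝ) ≤ 18 * (Int.log 2 (rootDist w u) - r v + 1) := by exact_mod_cast ht
    push_cast
    linarith
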